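/- \textbf{Conventions.} All factors are von Neumann factors of type III, and homomorphisms are unital normal $*$-homomorphisms. For homomorphisms $\rho,\sigma:P\to Q$ put $\mathrm{Hom}(\rho,\sigma)=\{t\in Q: t\rho(x)=\sigma(x)t\ \forall x\in P\}$; for $s\in \mathrm{Hom}(\rho,\rho')$, $t\in \mathrm{Hom}(\sigma,\sigma')$ put $s\times t=s\,\rho(t)\in \mathrm{Hom}(\rho\sigma,\rho'\sigma')$. A homomorphism $\rho:P\to Q$ has \emph{finite dimension} if there are $\bar\rho:Q\to P$, $d>0$ and isometries $R\in \mathrm{Hom}(\mathrm{id}_P,\bar\rho\rho)$, $\bar R\in \mathrm{Hom}(\mathrm{id}_Q,\rho\bar\rho)$ with $\rho(R^*)\bar R=d^{-1}1$ and $\bar\rho(\bar R^*)R=d^{-1}1$; then $\bar\rho$ is a conjugate of $\rho$, and the dimension $d(\rho)$ is the infimum of all such $d$. A subfactor has finite index if its inclusion homomorphism has finite dimension. A \emph{closed $N$-system} is a set $\Delta$ of mutually inequivalent irreducible endomorphisms of $N$ of finite dimension such that $\mathrm{id}_N\in\Delta$, each $\lambda\in\Delta$ has a conjugate $\bar\lambda\in\Delta$,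 and for $\lambda,\mu\in\Delta$ the product $\lambda\mu$ is equivalent to a finite direct sum of elements of $\Delta$. An \emph{extension} of $\Delta$ is a pair $(\iota,\alpha)$, where $\iota$ is the inclusion homomorphism of a finite index subfactor $N\subset M$ and $\lambda\mapsto\alpha_\lambda$ is a map from $\Delta$ to the endomorphisms of $M$ of finite dimension, such that (E1) $\iota\circ\lambda=\alpha_\lambda\circ\iota$ and (E2) $\iota(\mathrm{Hom}(\nu,\lambda\mu))\subset \mathrm{Hom}(\alpha_\nu,\alpha_\lambda\alpha_\mu)$ for all $\lambda,\mu,\nu\in\Delta$. \textbf{Setting.} Let $N_1,N_2\subset M$ be subfactors, let $\Delta_i$ be a finite closed $N_i$-system and $(\iota_i,\alpha^i)$ an extension of $\Delta_i$ ($i=1,2$). Let $A=N_1\otimes N_2^{\rm opp}$ be the von Neumann tensor product of $N_1$ with the opposite algebra of $N_2$, let $Z_{\lambda_1,\lambda_2}=\dim \mathrm{Hom}(\alpha^1_{\lambda_1},\alpha^2_{\lambda_2})$, and let $l=(\lambda_1,\lambda_2,k)$ run over the multi-indices with $\lambda_i\in\Delta_i$, $1\le k\le Z_{\lambda_1,\lambda_2}$.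 In the formulas below $l,m,n$ are multi-indices belonging to $(\lambda_1,\lambda_2)$, $(\mu_1,\mu_2)$, $(\nu_1,\nu_2)$, respectively. Choose (a) isometries $W_l\in A$ with $W_l^*W_m=\delta_{lm}1$ and $\sum_l W_lW_l^*=1$, and put $\theta=\sum_l W_l\,(\lambda_1\otimes\lambda_2^{\rm opp})(\cdot)\,W_l^*$, so that $W_l\in\mathrm{Hom}(\lambda_1\otimes\lambda_2^{\rm opp},\theta)$; (b) bases $T_{e_i}$ of the spaces $\mathrm{Hom}(\nu_i,\lambda_i\mu_i)$ consisting of isometries with $T_e^*T_f=\delta_{ef}1$; (c) for $\lambda\in\Delta_1$ a conjugate $\bar\lambda\in\Delta_1$ with isometries $R_\lambda,\bar R_\lambda$ as above for $d=d(\lambda)$, giving the left-inverse $\Phi^1_{\lambda}(x)=\iota_1(R_\lambda)^*\,\alpha^1_{\bar\lambda}(x)\,\iota_1(R_\lambda)$ of $\alpha^1_\lambda$; (d) for all $\lambda_1,\lambda_2$ a basis $\{\phi_l\}$ of $\mathrm{Hom}(\alpha^1_{\lambda_1},\alpha^2_{\lambda_2})$ that is orthonormal for $(\phi,\phi')=\Phi^1_{\lambda_1}(\phi^*\phi')$.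 The \emph{canonical isometry} $w_1\in\mathrm{Hom}(\theta,\theta^2)$ is $$w_1=\sum_{l,m,n}(W_l\times W_m)\Big(\sum_{e_1,e_2}\zeta^n_{lm,e_1e_2}\;T_{e_1}\otimes(T_{e_2}^*)^{\rm opp}\Big)W_n^*,$$ $$\zeta^n_{lm,e_1e_2}=\sqrt{\frac{d(\lambda_2)d(\mu_2)}{d(\theta)d(\nu_2)}}\;\Phi^1_{\nu_1}\big[\iota_1(T_{e_1}^*)(\phi_l^*\times\phi_m^*)\,\iota_2(T_{e_2})\,\phi_n\big]\in\mathbb C .$$ \textbf{Proposition 1.} Assume in addition that $\Delta_1$ and $\Delta_2$ are braided with unitary braidings $\varepsilon_1$ and $\varepsilon_2$; that is, $\varepsilon_i$ is a natural family of unitaries $\varepsilon_i(\rho,\sigma)\in \mathrm{Hom}(\rho\sigma,\sigma\rho)$ satisfying the hexagon identities and turning the full category of endomorphisms with objects $\Pi(\Delta_i)$ (the finite products of elements of $\Delta_i$) into a braided monoidal category. Suppose that for all $\lambda_i,\mu_i\in\Delta_i$ and all $\phi\in \mathrm{Hom}(\alpha^1_{\lambda_1},\alpha^2_{\lambda_2})$,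 $\psi\in \mathrm{Hom}(\alpha^1_{\mu_1},\alpha^2_{\mu_2})$ $$\text{(E3)}\qquad (\psi\times\phi)\,\iota_1(\varepsilon_1(\lambda_1,\mu_1))=\iota_2(\varepsilon_2(\lambda_2,\mu_2))\,(\phi\times\psi).$$ Then, for all choices (a)--(d), $w_1$ and the braiding operator naturally induced by $\varepsilon_1$ and $\varepsilon_2^{\rm opp}$, $$\varepsilon(\theta,\theta)=\sum_{l,m}(W_m\times W_l)\,\big(\varepsilon_1(\lambda_1,\mu_1)\otimes(\varepsilon_2(\lambda_2,\mu_2)^*)^{\rm opp}\big)\,(W_l\times W_m)^*,$$ satisfy $$\varepsilon(\theta,\theta)\,w_1=w_1 .$$ -/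

import Mathlib

namespace SectorSystems

open scoped TensorProduct BigOperators
open UniformSpace

noncomputable section

/-! ### Intertwiners, conjugates and dimension -/

section Algebra

variable {P Q : Type*} [Ring P] [StarRing P] [Algebra ℂ P] [PartialOrder P]
  [Ring Q] [StarRing Q] [Algebra ℂ Q] [PartialOrder Q]

/-- The space of intertwiners `t : ρ → σ`, i.e. `t ρ(x) = σ(x) t` for all `x`. -/
def Hom (ρ σ : P →⋆ₐ[ℂ] Q) : Submodule ℂ Q where
  carrier := {t | ∀ x, t * ρ x = σ x * t}
  add_mem' {a b} ha hb x := by rw [add_mul, mul_add, ha x, hb x]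
  zero_mem' x := by rw [zero_mul, mul_zero]
  smul_mem' c a ha x := by rw [smul_mul_assoc, mul_smul_comm, ha x]

/-- The monoidal product `s × t = s ρ(t)` of intertwiners `s : ρ → ρ'` and `t : σ → σ'`,
an intertwiner `ρσ → ρ'σ'`. The source `ρ` of `s` is an explicit argument. -/
def cross (ρ : P →⋆ₐ[ℂ] P) (s t : P) : P := s * ρ t

/-- A homomorphism is normal if it preserves least upper bounds of upward directed sets. -/
def IsNormal (ρ : P →⋆ₐ[ℂ] Q) : Prop :=
  ∀ S : Set P, S.Nonempty → DirectedOn (· ≤ ·) S → ∀ a, IsLUB S a → IsLUB (ρ '' S) (ρ a)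

/-- `R : id → ρ' ρ` and `R' : id → ρ ρ'` are isometries which solve the conjugate equations
`(1_ρ × R*)(R' × 1_ρ) = d⁻¹ 1_ρ` and `(1_ρ' × R'*)(R × 1_ρ') = d⁻¹ 1_ρ'`. -/
structure ConjugateSolution (ρ : P →⋆ₐ[ℂ] Q) (ρ' : Q →⋆ₐ[ℂ] P) (d : ℝ) (R : P) (R' : Q) :
    Prop where
  pos : 0 < d
  mem : R ∈ Hom (StarAlgHom.id ℂ P) (ρ'.comp ρ)
  mem' : R' ∈ Hom (StarAlgHom.id ℂ Q) (ρ.comp ρ')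
  isometry : star R * R = 1
  isometry' : star R' * R' = 1
  conj_eq : ρ (star R) * R' = ((d : ℂ)⁻¹) • (1 : Q)
  conj_eq' : ρ' (star R') * R = ((d : ℂ)⁻¹) • (1 : P)

/-- `ρ'` is a (normal) conjugate homomorphism of `ρ`. -/
def IsConjugate (ρ : P →⋆ₐ[ℂ] Q) (ρ' : Q →⋆ₐ[ℂ] P) : Prop :=
  IsNormal ρ' ∧ ∃ d R R', ConjugateSolution ρ ρ' d R R'

/-- `ρ` is a normal unital homomorphism of finite dimension, i.e. it has a conjugate.
For an inclusion of infinite factors this says that the index is finite. -/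
def FiniteDim (ρ : P →⋆ₐ[ℂ] Q) : Prop :=
  IsNormal ρ ∧ ∃ ρ', IsConjugate ρ ρ'

/-- The (minimal) dimension of a homomorphism. -/
def dim (ρ : P →⋆ₐ[ℂ] Q) : ℝ :=
  sInf {d : ℝ | ∃ ρ' R R', IsNormal ρ' ∧ ConjugateSolution ρ ρ' d R R'}

/-- The complex number `c` with `x = c 1`, for a scalar element `x`. -/
def scalarValue (x : P) : ℂ := Classical.epsilon fun c : ℂ => x = c • (1 : P)

/-- Unitary equivalence (equality of sectors). -/
def Equivalent (ρ σ : P →⋆ₐ[ℂ] P) : Prop :=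
  ∃ u ∈ Hom ρ σ, star u * u = 1 ∧ u * star u = 1

/-- `ρ` is equivalent to a finite direct sum of elements of `Δ`, i.e.
`ρ = ∑ i, V i σ_i( · ) (V i)*` with a complete finite system of orthonormal isometries. -/
def IsFiniteSum (Δ : Set (P →⋆ₐ[ℂ] P)) (ρ : P →⋆ₐ[ℂ] P) : Prop :=
  ∃ (n : ℕ) (σ : Fin n → Δ) (V : Fin n → P),
    (∀ i, V i ∈ Hom (σ i : P →⋆ₐ[ℂ] P) ρ) ∧
    (∀ i, star (V i) * V i = 1) ∧ (∀ i j, i ≠ j → star (V i) * V j = 0) ∧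
    ∑ i, V i * star (V i) = 1

/-- Closed systems of mutually inequivalent irreducible endomorphisms of finite dimension.
The product of endomorphisms is composition. -/
structure IsClosedSystem (Δ : Set (P →⋆ₐ[ℂ] P)) : Prop where
  finiteDim : ∀ ρ ∈ Δ, FiniteDim ρ
  irreducible : ∀ ρ ∈ Δ, ∀ t ∈ Hom ρ ρ, ∃ c : ℂ, t = c • (1 : P)
  inequivalent : ∀ ρ ∈ Δ, ∀ σ ∈ Δ, Equivalent ρ σ → ρ = σ
  id_mem : StarAlgHom.id ℂ P ∈ Δ
  conjugate : ∀ ρ ∈ Δ, ∃ ρ' ∈ Δ, IsConjugate ρ ρ'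
  fusion : ∀ ρ ∈ Δ, ∀ σ ∈ Δ, IsFiniteSum Δ (ρ * σ)

/-- `(ι, α)` is an extension of the system `Δ`. -/
structure IsExtension (ι : P →⋆ₐ[ℂ] Q) (Δ : Set (P →⋆ₐ[ℂ] P)) (α : Δ → (Q →⋆ₐ[ℂ] Q)) :
    Prop where
  finiteIndex : FiniteDim ι
  finiteDim : ∀ ρ, FiniteDim (α ρ)
  comm : ∀ ρ : Δ, ι.comp (ρ : P →⋆ₐ[ℂ] P) = (α ρ).comp ι
  map_hom : ∀ τ ρ σ : Δ, ∀ t ∈ Hom (τ : P →⋆ₐ[ℂ] P) (ρ * σ), ι t ∈ Hom (α τ) (α ρ * α σ)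

/-- A unitary braiding on the strict monoidal category with objects `Π(Δ)`, the finite products of
elements of `Δ`, and the intertwiners as arrows. -/
structure UnitaryBraiding (Δ : Set (P →⋆ₐ[ℂ] P)) where
  ε : Submonoid.closure Δ → Submonoid.closure Δ → P
  mem_hom : ∀ ρ σ : Submonoid.closure Δ, ε ρ σ ∈ Hom (ρ * σ : P →⋆ₐ[ℂ] P) (σ * ρ)
  star_mul_self : ∀ ρ σ, star (ε ρ σ) * ε ρ σ = 1
  mul_star_self : ∀ ρ σ, ε ρ σ * star (ε ρ σ) = 1
  natural : ∀ ρ ρ' σ σ' : Submonoid.closure Δ,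
    ∀ s ∈ Hom (ρ : P →⋆ₐ[ℂ] P) ρ', ∀ t ∈ Hom (σ : P →⋆ₐ[ℂ] P) σ',
      ε ρ' σ' * cross ρ s t = cross σ t s * ε ρ σ
  mul_left : ∀ ρ σ τ : Submonoid.closure Δ,
    ε (ρ * σ) τ = cross (ρ * τ : P →⋆ₐ[ℂ] P) (ε ρ τ) 1 * cross ρ 1 (ε σ τ)
  mul_right : ∀ ρ σ τ : Submonoid.closure Δ,
    ε ρ (σ * τ) = cross σ 1 (ε ρ τ) * cross (ρ * σ : P →⋆ₐ[ℂ] P) (ε ρ σ) 1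

/-- The braiding operator of two elements of `Δ`. -/
def UnitaryBraiding.op {Δ : Set (P →⋆ₐ[ℂ] P)} (ε : UnitaryBraiding Δ) (ρ σ : Δ) : P :=
  ε.ε ⟨ρ, Submonoid.subset_closure ρ.2⟩ ⟨σ, Submonoid.subset_closure σ.2⟩

/-- A choice of conjugates in `Δ` and of isometries implementing the standard left-inverses. -/
structure ConjugateChoice (Δ : Set (P →⋆ₐ[ℂ] P)) where
  bar : Δ → Δ
  R : Δ → P
  R' : Δ → P
  solution : ∀ ρ : Δ,
    ConjugateSolution (ρ : P →⋆ₐ[ℂ] P) (bar ρ) (dim (ρ : P →⋆ₐ[ℂ] P)) (R ρ) (R' ρ)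

/-- The left-inverse `x ↦ ι(R_ρ)* α_ρ̄(x) ι(R_ρ)` of `α_ρ` induced by `ι(R_ρ)`. -/
def ConjugateChoice.leftInverse {Δ : Set (P →⋆ₐ[ℂ] P)} (c : ConjugateChoice Δ)
    (ι : P →⋆ₐ[ℂ] Q) (α : Δ → (Q →⋆ₐ[ℂ] Q)) (ρ : Δ) (x : Q) : Q :=
  star (ι (c.R ρ)) * α (c.bar ρ) x * ι (c.R ρ)

/-- A choice of orthonormal isometric bases `T_e` of the intertwiner spaces `Hom(τ, ρσ)`. -/
structure FusionBases (Δ : Set (P →⋆ₐ[ℂ] P)) where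
  T : ∀ τ ρ σ : Δ, Fin (Module.finrank ℂ (Hom (τ : P →⋆ₐ[ℂ] P) (ρ * σ))) → P
  isometry : ∀ τ ρ σ e, star (T τ ρ σ e) * T τ ρ σ e = 1
  orthogonal : ∀ τ ρ σ e f, e ≠ f → star (T τ ρ σ e) * T τ ρ σ f = 0
  span : ∀ τ ρ σ : Δ,
    Submodule.span ℂ (Set.range (T τ ρ σ)) = Hom (τ : P →⋆ₐ[ℂ] P) (ρ * σ)

end Algebra

/-- The coupling matrix `Z = dim Hom(α¹, α²)`. -/
def couplingMatrix {Q I₁ I₂ : Type*} [Ring Q] [StarRing Q] [Algebra ℂ Q]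
    (α₁ : I₁ → (Q →⋆ₐ[ℂ] Q)) (α₂ : I₂ → (Q →⋆ₐ[ℂ] Q)) (i : I₁) (j : I₂) : ℕ :=
  Module.finrank ℂ (Hom (α₁ i) (α₂ j))

/-- The multi-indices `l = (i, j, k)` with `k = 1, …, Z i j`. -/
abbrev MultiIndex {Q I₁ I₂ : Type*} [Ring Q] [StarRing Q] [Algebra ℂ Q]
    (α₁ : I₁ → (Q →⋆ₐ[ℂ] Q)) (α₂ : I₂ → (Q →⋆ₐ[ℂ] Q)) : Type _ :=
  Σ p : I₁ × I₂, Fin (couplingMatrix α₁ α₂ p.1 p.2)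

/-! ### Von Neumann algebras -/

section VonNeumann

variable {H : Type*} [NormedAddCommGroup H] [InnerProductSpace ℂ H] [CompleteSpace H]
  {K : Type*} [NormedAddCommGroup K] [InnerProductSpace ℂ K] [CompleteSpace K]

/-- The *-algebra of elements of a von Neumann algebra. -/
abbrev Elt (N : VonNeumannAlgebra H) : Type _ := N.toStarSubalgebra

/-- The inclusion homomorphism of a von Neumann subalgebra. -/
def inclusionHom {N M : VonNeumannAlgebra H} (h : N ≤ M) : Elt N →⋆ₐ[ℂ] Elt M :=
  StarSubalgebra.inclusion (S₁ := N.toStarSubalgebra) (S₂ := M.toStarSubalgebra) h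

/-- Type III factors: the centre is trivial and every non-zero projection is infinite. -/
structure IsTypeIIIFactor (N : VonNeumannAlgebra H) : Prop where
  nontrivial : Nontrivial (Elt N)
  center : ∀ z : Elt N, (∀ x, z * x = x * z) → ∃ c : ℂ, z = c • (1 : Elt N)
  infinite : ∀ p : Elt N, IsStarProjection p → p ≠ 0 →
    ∃ v : Elt N, star v * v = p ∧ v * star v ≤ p ∧ v * star v ≠ p

/-- The dual of a Hilbert space is a Hilbert space (the conjugate Hilbert space). -/
instance dualInnerProductSpace : InnerProductSpace ℂ (StrongDual ℂ H) where
  inner f g := inner ℂ ((InnerProductSpace.toDual ℂ H).symm g)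
    ((InnerProductSpace.toDual ℂ H).symm f)
  norm_sq_eq_re_inner f := by
    rw [← (InnerProductSpace.toDual ℂ H).symm.norm_map f]
    exact norm_sq_eq_re_inner (𝕜 := ℂ) _
  conj_inner_symm f g := inner_conj_symm _ _
  add_left f g h := by simp only [map_add, inner_add_right]
  smul_left f g r := by
    rw [LinearIsometryEquiv.map_smulₛₗ, inner_smul_right]

/-- The transposed operator `f ↦ f ∘ y` on the dual Hilbert space. The map `y ↦ transpose y` is
linear, *-preserving and antimultiplicative, so it represents the opposite algebra. -/
def transpose (y : H →L[ℂ] H) : StrongDual ℂ H →L[ℂ] StrongDual ℂ H :=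
  ContinuousLinearMap.precomp ℂ y

/-- The Hilbert space tensor product. -/
abbrev HilbertTensor (H K : Type*) [NormedAddCommGroup H] [InnerProductSpace ℂ H]
    [NormedAddCommGroup K] [InnerProductSpace ℂ K] : Type _ :=
  Completion (H ⊗[ℂ] K)

/-- The operator `x ⊗ yᵒᵖᵖ`. -/
def tensorOperator (x : H →L[ℂ] H) (y : K →L[ℂ] K) :
    HilbertTensor H (StrongDual ℂ K) →L[ℂ] HilbertTensor H (StrongDual ℂ K) :=
  (TensorProduct.mapL x (transpose y)).completion

/-- The von Neumann algebra generated by a set of operators (together with their adjoints). -/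
def generated (S : Set (H →L[ℂ] H)) : VonNeumannAlgebra H where
  toStarSubalgebra := StarSubalgebra.centralizer ℂ
    (StarSubalgebra.centralizer ℂ S : Set (H →L[ℂ] H))
  centralizer_centralizer' := by
    change Set.centralizer (Set.centralizer
      (StarSubalgebra.centralizer ℂ (StarSubalgebra.centralizer ℂ S : Set (H →L[ℂ] H)) :
        Set (H →L[ℂ] H))) =
      (StarSubalgebra.centralizer ℂ (StarSubalgebra.centralizer ℂ S : Set (H →L[ℂ] H)) :
        Set (H →L[ℂ] H))
    simp only [StarSubalgebra.coe_centralizer, Set.centralizer_centralizer_centralizer]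

theorem subset_generated (S : Set (H →L[ℂ] H)) :
    ∀ x ∈ S, x ∈ (generated S).toStarSubalgebra := by
  intro x hx
  change x ∈ StarSubalgebra.centralizer ℂ
    (StarSubalgebra.centralizer ℂ S : Set (H →L[ℂ] H))
  rw [StarSubalgebra.mem_centralizer_iff]
  intro g hg
  have h := (StarSubalgebra.mem_centralizer_iff ℂ).1 hg x hx
  exact ⟨h.1.symm, by simpa using congrArg star h.2⟩

/-- The von Neumann algebra tensor product `N₁ ⊗ N₂ᵒᵖᵖ`. -/
def tensorOpp (N₁ : VonNeumannAlgebra H) (N₂ : VonNeumannAlgebra K) :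
    VonNeumannAlgebra (HilbertTensor H (StrongDual ℂ K)) :=
  generated {T | ∃ x ∈ N₁, ∃ y ∈ N₂, T = tensorOperator x y}

variable {N₁ : VonNeumannAlgebra H} {N₂ : VonNeumannAlgebra K}

/-- The element `x ⊗ yᵒᵖᵖ` of `N₁ ⊗ N₂ᵒᵖᵖ`. -/
def tmul (x : Elt N₁) (y : Elt N₂) : Elt (tensorOpp N₁ N₂) :=
  ⟨tensorOperator x.1 y.1, subset_generated _ _ ⟨x.1, x.2, y.1, y.2, rfl⟩⟩

/-- The endomorphism `ρ ⊗ σᵒᵖᵖ` of `N₁ ⊗ N₂ᵒᵖᵖ`: the (unique) normal unital endomorphism with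
`x ⊗ yᵒᵖᵖ ↦ ρ(x) ⊗ σ(y)ᵒᵖᵖ`. For normal `ρ` and `σ` it exists; uniqueness holds because the
linear span of the elements `x ⊗ yᵒᵖᵖ` is weakly dense. -/
def tensorEnd (ρ : Elt N₁ →⋆ₐ[ℂ] Elt N₁) (σ : Elt N₂ →⋆ₐ[ℂ] Elt N₂) :
    Elt (tensorOpp N₁ N₂) →⋆ₐ[ℂ] Elt (tensorOpp N₁ N₂) :=
  Classical.epsilon fun Θ => IsNormal Θ ∧ ∀ x y, Θ (tmul x y) = tmul (ρ x) (σ y)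

end VonNeumann

/-! ### The canonical triple and the induced braiding -/

section Canonical

variable {A : Type*} [Ring A] [StarRing A] [Algebra ℂ A]

/-- A complete finite system of isometries with mutually orthogonal ranges. -/
structure IsometrySystem (I : Type*) [Fintype I] (A : Type*) [Ring A] [StarRing A] where
  W : I → A
  isometry : ∀ l, star (W l) * W l = 1
  orthogonal : ∀ l m, l ≠ m → star (W l) * W m = 0
  complete : ∑ l, W l * star (W l) = 1

/-- The direct sum endomorphism `∑ l, W_l Λ_l( · ) W_l*`. -/
def IsometrySystem.directSum {I : Type*} [Fintype I] (W : IsometrySystem I A)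
    (Λ : I → (A →⋆ₐ[ℂ] A)) : A →⋆ₐ[ℂ] A where
  toFun a := ∑ l, W.W l * Λ l a * star (W.W l)
  map_one' := by simpa using W.complete
  map_mul' a b := by
    rw [Finset.sum_mul_sum]
    refine Finset.sum_congr rfl fun l _ => ?_
    rw [Finset.sum_eq_single l]
    · have h := W.isometry l
      calc W.W l * Λ l (a * b) * star (W.W l)
          = W.W l * Λ l a * (1 * (Λ l b * star (W.W l))) := by
            rw [map_mul, one_mul]; simp only [mul_assoc]
        _ = _ := by rw [← h]; simp only [mul_assoc]
    · intro m _ hm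
      have h := W.orthogonal l m (Ne.symm hm)
      calc W.W l * Λ l a * star (W.W l) * (W.W m * Λ m b * star (W.W m))
          = W.W l * Λ l a * ((star (W.W l) * W.W m) * (Λ m b * star (W.W m))) := by
            simp only [mul_assoc]
        _ = 0 := by rw [h, zero_mul, mul_zero]
    · intro h
      exact absurd (Finset.mem_univ l) h
  map_zero' := by simp
  map_add' a b := by
    simp only [map_add, mul_add, add_mul, Finset.sum_add_distrib]
  commutes' c := by
    have h : ∀ l, W.W l * Λ l (algebraMap ℂ A c) * star (W.W l) =
        algebraMap ℂ A c * (W.W l * star (W.W l)) := fun l => by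
      rw [AlgHomClass.commutes, ← Algebra.commutes, mul_assoc]
    simp only [h, ← Finset.mul_sum, W.complete, mul_one]
  map_star' a := by
    simp only [star_sum, star_mul, star_star, map_star, mul_assoc]

end Canonical

section Construction

variable {H : Type*} [NormedAddCommGroup H] [InnerProductSpace ℂ H] [CompleteSpace H]
  {N₁ N₂ M : VonNeumannAlgebra H}
  {Δ₁ : Set (Elt N₁ →⋆ₐ[ℂ] Elt N₁)} {Δ₂ : Set (Elt N₂ →⋆ₐ[ℂ] Elt N₂)}
  {α₁ : Δ₁ → (Elt M →⋆ₐ[ℂ] Elt M)} {α₂ : Δ₂ → (Elt M →⋆ₐ[ℂ] Elt M)}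

/-- A choice, for all `λ₁`, `λ₂`, of a basis of `Hom(α¹_λ₁, α²_λ₂)` which is orthonormal
with respect to the scalar product `(φ, φ') = Φ¹_λ₁(φ* φ')`, where `Φ¹_λ₁` is the left-inverse of
`α¹_λ₁` induced by `ι₁` of the isometries `c.R`. -/
structure TransitionBases (ι₁ : Elt N₁ →⋆ₐ[ℂ] Elt M) (c : ConjugateChoice Δ₁)
    (α₁ : Δ₁ → (Elt M →⋆ₐ[ℂ] Elt M)) (α₂ : Δ₂ → (Elt M →⋆ₐ[ℂ] Elt M)) where
  φ : MultiIndex α₁ α₂ → Elt M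
  normalized : ∀ p k, c.leftInverse ι₁ α₁ p.1 (star (φ ⟨p, k⟩) * φ ⟨p, k⟩) = 1
  orthogonal : ∀ p k k', k ≠ k' →
    c.leftInverse ι₁ α₁ p.1 (star (φ ⟨p, k⟩) * φ ⟨p, k'⟩) = 0
  span : ∀ p : Δ₁ × Δ₂,
    Submodule.span ℂ (Set.range fun k => φ ⟨p, k⟩) = Hom (α₁ p.1) (α₂ p.2)

variable [Fintype Δ₁] [Fintype Δ₂]

/-- The endomorphism `λ₁ ⊗ λ₂ᵒᵖᵖ` of `N₁ ⊗ N₂ᵒᵖᵖ` belonging to a multi-index. -/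
def component (l : MultiIndex α₁ α₂) :
    Elt (tensorOpp N₁ N₂) →⋆ₐ[ℂ] Elt (tensorOpp N₁ N₂) :=
  tensorEnd (l.1.1 : Elt N₁ →⋆ₐ[ℂ] Elt N₁) (l.1.2 : Elt N₂ →⋆ₐ[ℂ] Elt N₂)

/-- The dual canonical endomorphism `θ = ∑ l, W_l (λ₁ ⊗ λ₂ᵒᵖᵖ)( · ) W_l*`. -/
def theta (W : IsometrySystem (MultiIndex α₁ α₂) (Elt (tensorOpp N₁ N₂))) :
    Elt (tensorOpp N₁ N₂) →⋆ₐ[ℂ] Elt (tensorOpp N₁ N₂) :=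
  W.directSum component

/-- The product `W_l × W_m`, an intertwiner
`(λ₁ ⊗ λ₂ᵒᵖᵖ)(μ₁ ⊗ μ₂ᵒᵖᵖ) → θ²`. -/
def crossW (W : IsometrySystem (MultiIndex α₁ α₂) (Elt (tensorOpp N₁ N₂)))
    (l m : MultiIndex α₁ α₂) : Elt (tensorOpp N₁ N₂) :=
  cross (component l) (W.W l) (W.W m)

/-- The coefficients
`ζ = √(d(λ₂) d(μ₂) / (d(θ) d(ν₂))) Φ¹_ν₁[ι₁(T_{e₁}*) (φ_l* × φ_m*) ι₂(T_{e₂}) φ_n]`,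
where `λ, μ, ν` are the sectors of `l, m, n`. -/
def zeta (ι₁ : Elt N₁ →⋆ₐ[ℂ] Elt M) (ι₂ : Elt N₂ →⋆ₐ[ℂ] Elt M)
    (c : ConjugateChoice Δ₁) (T₁ : FusionBases Δ₁) (T₂ : FusionBases Δ₂)
    (φ : TransitionBases ι₁ c α₁ α₂)
    (W : IsometrySystem (MultiIndex α₁ α₂) (Elt (tensorOpp N₁ N₂)))
    (l m n : MultiIndex α₁ α₂)
    (e₁ : Fin (Module.finrank ℂ (Hom (n.1.1 : Elt N₁ →⋆ₐ[ℂ] Elt N₁) (l.1.1 * m.1.1))))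
    (e₂ : Fin (Module.finrank ℂ (Hom (n.1.2 : Elt N₂ →⋆ₐ[ℂ] Elt N₂) (l.1.2 * m.1.2)))) : ℂ :=
  (Real.sqrt (dim (l.1.2 : Elt N₂ →⋆ₐ[ℂ] Elt N₂) * dim (m.1.2 : Elt N₂ →⋆ₐ[ℂ] Elt N₂) /
      (dim (theta W) * dim (n.1.2 : Elt N₂ →⋆ₐ[ℂ] Elt N₂))) : ℂ) *
    scalarValue (c.leftInverse ι₁ α₁ n.1.1
      (ι₁ (star (T₁.T n.1.1 l.1.1 m.1.1 e₁)) *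
        cross (α₂ l.1.2) (star (φ.φ l)) (star (φ.φ m)) *
        ι₂ (T₂.T n.1.2 l.1.2 m.1.2 e₂) * φ.φ n))

/-- The canonical element
`w₁ = ∑ l m n, (W_l × W_m) (∑ e₁ e₂, ζ T_{e₁} ⊗ (T_{e₂}*)ᵒᵖᵖ) W_n*`. -/
def w₁ (ι₁ : Elt N₁ →⋆ₐ[ℂ] Elt M) (ι₂ : Elt N₂ →⋆ₐ[ℂ] Elt M)
    (c : ConjugateChoice Δ₁) (T₁ : FusionBases Δ₁) (T₂ : FusionBases Δ₂)
    (φ : TransitionBases ι₁ c α₁ α₂)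
    (W : IsometrySystem (MultiIndex α₁ α₂) (Elt (tensorOpp N₁ N₂))) : Elt (tensorOpp N₁ N₂) :=
  ∑ l, ∑ m, ∑ n, crossW W l m *
    (∑ e₁, ∑ e₂, zeta ι₁ ι₂ c T₁ T₂ φ W l m n e₁ e₂ •
      tmul (T₁.T n.1.1 l.1.1 m.1.1 e₁) (star (T₂.T n.1.2 l.1.2 m.1.2 e₂))) *
    star (W.W n)

/-- The braiding operator
`ε(θ, θ) = ∑ l m, (W_m × W_l) (ε₁(λ₁, μ₁) ⊗ (ε₂(λ₂, μ₂)*)ᵒᵖᵖ) (W_l × W_m)*`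
naturally induced by the braidings `ε₁` and `ε₂ᵒᵖᵖ`. -/
def inducedBraiding (ε₁ : UnitaryBraiding Δ₁) (ε₂ : UnitaryBraiding Δ₂)
    (W : IsometrySystem (MultiIndex α₁ α₂) (Elt (tensorOpp N₁ N₂))) : Elt (tensorOpp N₁ N₂) :=
  ∑ l, ∑ m, crossW W m l *
    tmul (ε₁.op l.1.1 m.1.1) (star (ε₂.op l.1.2 m.1.2)) * star (crossW W l m)

end Construction

end

end SectorSystems

/-! The braiding operator is applied to `w₁` one pair of multi-indices at a time. The isometries
`W_l × W_m` are orthonormal, so the claim reduces to the identity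
`∑ ζ_{lm,e₁e₂} ε₁ T_{e₁} ⊗ (T_{e₂}* ε₂*)ᵒᵖᵖ = ∑ ζ_{ml,f₁f₂} T_{f₁} ⊗ (T_{f₂}*)ᵒᵖᵖ`
for all `l`, `m`, `n` (`braiding_mul_coefficients`). Now `ε_i` maps `Hom(ν_i, λ_i μ_i)` unitarily onto
`Hom(ν_i, μ_i λ_i)`, so `ε_i T_e = ∑ f, u_{fe} T_f` and `ε_i* T_f = ∑ e, ū_{fe} T_e` with the same
coefficients (`exists_unitary_coefficients`). The two matrices can therefore be moved from the
operators onto the arguments `ι₁(T_{e₁}*)` and `ι₂(T_{e₂})` of the coefficient `ζ`, where they turn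
`φ_l* × φ_m*` into `ι₁(ε₁) (φ_l* × φ_m*) ι₂(ε₂)*`. By the adjoint of (E3) this is `φ_m* × φ_l*`
(`braiding_conj_star_cross`), which gives `ζ_{ml}`; the numerical prefactor is symmetric in
`l`, `m`.

Moving the matrices into `ζ` uses that `x ↦ Φ¹_ν(x)`, read as a complex number, is linear on
`Hom(α¹_ν, α¹_ν)`. It is, because `ι₁(R_ν)` intertwines `id_M` and `α¹_ν̄ α¹_ν`, so `Φ¹_ν` maps this
space into the centre of `M` (`leftInverse_scalar`). -/

namespace SectorSystems

open scoped TensorProduct BigOperators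
open UniformSpace

/-! ### Calculus of intertwiners -/

section Intertwiners

variable {P Q : Type*} [Ring P] [StarRing P] [Algebra ℂ P] [Ring Q] [StarRing Q] [Algebra ℂ Q]

theorem mul_mem_Hom {ρ σ τ : P →⋆ₐ[ℂ] Q} {s t : Q} (hs : s ∈ Hom σ τ) (ht : t ∈ Hom ρ σ) :
    s * t ∈ Hom ρ τ := fun x => by
  rw [mul_assoc, ht x, ← mul_assoc, hs x, mul_assoc]

theorem star_mem_Hom {ρ σ : P →⋆ₐ[ℂ] Q} {t : Q} (ht : t ∈ Hom ρ σ) : star t ∈ Hom σ ρ := fun x => by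
  have h := congrArg star (ht (star x))
  rw [star_mul, star_mul, ← map_star, ← map_star, star_star] at h
  exact h.symm

theorem cross_mem_Hom {ρ ρ' σ σ' : P →⋆ₐ[ℂ] P} {s t : P} (hs : s ∈ Hom ρ ρ')
    (ht : t ∈ Hom σ σ') : cross ρ s t ∈ Hom (ρ * σ) (ρ' * σ') := fun x => by
  change s * ρ t * ρ (σ x) = ρ' (σ' x) * (s * ρ t)
  rw [mul_assoc, ← map_mul, ht x, map_mul, ← mul_assoc, hs, mul_assoc]

theorem star_cross {ρ ρ' : P →⋆ₐ[ℂ] P} {s : P} (hs : s ∈ Hom ρ ρ') (t : P) :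
    star (cross ρ s t) = cross ρ' (star s) (star t) := by
  rw [cross, cross, star_mul, ← map_star]
  exact (star_mem_Hom hs (star t)).symm

/-- The adjoint of (E3), with both unitaries moved to the other side. -/
theorem braiding_conj_star_cross {ρ ρ' σ σ' : P →⋆ₐ[ℂ] P} {s t u v : P}
    (hs : s ∈ Hom ρ ρ') (ht : t ∈ Hom σ σ') (hu : u * star u = 1)
    (h : cross σ t s * u = v * cross ρ s t) :
    u * cross ρ' (star s) (star t) * star v = cross σ' (star t) (star s) := by
  have h' := congrArg star h
  rw [star_mul, star_mul, star_cross ht, star_cross hs] at h'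
  rw [mul_assoc, ← h', ← mul_assoc, hu, one_mul]

theorem sum_smul_star_mul_eq {ι : Type*} [Fintype ι] {S : ι → P}
    (isometry : ∀ e, star (S e) * S e = 1) (orthogonal : ∀ e f, e ≠ f → star (S e) * S f = 0)
    (a : ι → ℂ) (f : ι) : star (S f) * ∑ e, a e • S e = a f • 1 := by
  rw [Finset.mul_sum, Finset.sum_eq_single f]
  · rw [mul_smul_comm, isometry]
  · intro e _ he
    rw [mul_smul_comm, orthogonal f e he.symm, smul_zero]
  · simp

/-- If `u` maps the span of an orthonormal system `T` to that of an orthonormal system `S`, and `u*`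
maps it back, then the matrices of `u` and `u*` are adjoint to each other. -/
theorem exists_unitary_coefficients [StarModule ℂ P] [Nontrivial P] {ι κ : Type*} [Fintype ι]
    [Fintype κ] {T : ι → P} {S : κ → P} {u : P}
    (hT : ∀ e, star (T e) * T e = 1) (hT' : ∀ e f, e ≠ f → star (T e) * T f = 0)
    (hS : ∀ e, star (S e) * S e = 1) (hS' : ∀ e f, e ≠ f → star (S e) * S f = 0)
    (hu : ∀ e, u * T e ∈ Submodule.span ℂ (Set.range S))
    (hu' : ∀ f, star u * S f ∈ Submodule.span ℂ (Set.range T)) :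
    ∃ a : κ → ι → ℂ, (∀ e, u * T e = ∑ f, a f e • S f) ∧
      ∀ f, star u * S f = ∑ e, star (a f e) • T e := by
  simp only [Submodule.mem_span_range_iff_exists_fun] at hu hu'
  choose a ha using hu
  choose b hb using hu'
  refine ⟨fun f e => a e f, fun e => (ha e).symm, fun f => ?_⟩
  rw [← hb f]
  refine Finset.sum_congr rfl fun e _ => ?_
  have h₁ := sum_smul_star_mul_eq hS hS' (a e) f
  have h₂ := congrArg star (sum_smul_star_mul_eq hT hT' (b f) e)
  rw [ha] at h₁
  rw [hb] at h₂
  simp only [star_mul, star_star, star_smul, star_one, mul_assoc] at h₂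
  rw [h₁] at h₂
  have h₃ : a e f = star (b f e) := smul_left_injective ℂ (one_ne_zero (α := P)) h₂
  exact congrArg (· • T e) ((star_star (b f e)).symm.trans (congrArg star h₃.symm))

end Intertwiners

/-! ### Scalar values and left-inverses -/

section Scalars

variable {P Q : Type*} [Ring P] [StarRing P] [Algebra ℂ P] [PartialOrder P] [Ring Q] [Algebra ℂ Q]

theorem scalarValue_eq [Nontrivial Q] {x : Q} {a : ℂ} (h : x = a • (1 : Q)) :
    scalarValue x = a := by
  have h' : x = scalarValue x • (1 : Q) :=
    Classical.epsilon_spec (p := fun c : ℂ => x = c • 1) ⟨a, h⟩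
  exact smul_left_injective ℂ (one_ne_zero (α := Q)) (h'.symm.trans h)

theorem scalarValue_sum [Nontrivial Q] {ι : Type*} [Fintype ι] (a : ι → ℂ) {x : ι → Q}
    (h : ∀ i, ∃ z : ℂ, x i = z • (1 : Q)) :
    scalarValue (∑ i, a i • x i) = ∑ i, a i * scalarValue (x i) := by
  choose z hz using h
  apply scalarValue_eq
  rw [Finset.sum_smul]
  refine Finset.sum_congr rfl fun i _ => ?_
  rw [scalarValue_eq (hz i), mul_smul, ← hz i]

variable [StarRing Q]

theorem leftInverse_sum {Δ : Set (P →⋆ₐ[ℂ] P)} (c : ConjugateChoice Δ) (ι : P →⋆ₐ[ℂ] Q)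
    (α : Δ → (Q →⋆ₐ[ℂ] Q)) (ρ : Δ) {κ : Type*} [Fintype κ] (a : κ → ℂ) (x : κ → Q) :
    c.leftInverse ι α ρ (∑ i, a i • x i) = ∑ i, a i • c.leftInverse ι α ρ (x i) := by
  simp only [ConjugateChoice.leftInverse, map_sum, map_smul, Finset.mul_sum, Finset.sum_mul,
    mul_smul_comm, smul_mul_assoc]

variable [PartialOrder Q]

/-- A homomorphism of finite dimension is injective, since `x ↦ R* ρ̄(x) R` is a left-inverse. -/
theorem FiniteDim.injective {ρ : P →⋆ₐ[ℂ] Q} (h : FiniteDim ρ) : Function.Injective ρ := by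
  obtain ⟨-, ρ', -, d, R, R', hR⟩ := h
  have key : ∀ x, star R * (ρ' (ρ x) * R) = x := fun x => by
    have h₁ : R * x = ρ' (ρ x) * R := hR.mem x
    rw [← h₁, ← mul_assoc, hR.isometry, one_mul]
  intro x y hxy
  rw [← key x, hxy, key y]

variable {Δ : Set (P →⋆ₐ[ℂ] P)} {ι : P →⋆ₐ[ℂ] Q} {α : Δ → (Q →⋆ₐ[ℂ] Q)}

/-- By (E2), `1 ∈ Hom(id, id id)` gives `α_id = α_id²`, and `α_id` is injective. -/
theorem IsExtension.apply_id (hα : IsExtension ι Δ α) (h : StarAlgHom.id ℂ P ∈ Δ) (x : Q) :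
    α ⟨_, h⟩ x = x := by
  have h₁ : ι 1 * α ⟨_, h⟩ x = α ⟨_, h⟩ (α ⟨_, h⟩ x) * ι 1 :=
    hα.map_hom ⟨_, h⟩ ⟨_, h⟩ ⟨_, h⟩ 1 (fun y => by rw [one_mul, mul_one]; rfl) x
  rw [map_one, one_mul, mul_one] at h₁
  exact (hα.finiteDim _).injective h₁.symm

/-- The left-inverse `Φ_ρ` maps `Hom(α_ρ, α_ρ)` into the centre. -/
theorem leftInverse_scalar (hα : IsExtension ι Δ α) (hid : StarAlgHom.id ℂ P ∈ Δ)
    (hQ : ∀ z : Q, (∀ x, z * x = x * z) → ∃ a : ℂ, z = a • (1 : Q))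
    (c : ConjugateChoice Δ) (ρ : Δ) {t : Q} (ht : t ∈ Hom (α ρ) (α ρ)) :
    ∃ a : ℂ, c.leftInverse ι α ρ t = a • (1 : Q) := by
  have hR : ι (c.R ρ) ∈ Hom (StarAlgHom.id ℂ Q) (α (c.bar ρ) * α ρ) := fun x => by
    have h := hα.map_hom ⟨_, hid⟩ (c.bar ρ) ρ (c.R ρ) (c.solution ρ).mem x
    rwa [hα.apply_id hid] at h
  have ht' : α (c.bar ρ) t ∈ Hom (α (c.bar ρ) * α ρ) (α (c.bar ρ) * α ρ) := fun x => by
    change α (c.bar ρ) t * α (c.bar ρ) (α ρ x) = α (c.bar ρ) (α ρ x) * α (c.bar ρ) t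
    rw [← map_mul, ht x, map_mul]
  exact hQ _ (mul_mem_Hom (mul_mem_Hom (star_mem_Hom hR) ht') hR)

end Scalars

/-! ### The operators `x ⊗ yᵒᵖᵖ` -/

section Tensor

theorem completion_smul {E : Type*} [NormedAddCommGroup E] [NormedSpace ℂ E] (a : ℂ)
    (f : E →L[ℂ] E) : (a • f).completion = a • f.completion :=
  ContinuousLinearMap.ext fun v => Completion.induction_on v
    (isClosed_eq (ContinuousLinearMap.continuous _) (ContinuousLinearMap.continuous _)) fun v => by
      rw [smul_apply, ContinuousLinearMap.completion_apply_coe,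
        ContinuousLinearMap.completion_apply_coe]
      exact Completion.coe_smul a (f v)

theorem completion_add {E : Type*} [NormedAddCommGroup E] [NormedSpace ℂ E] (f g : E →L[ℂ] E) :
    (f + g).completion = f.completion + g.completion :=
  ContinuousLinearMap.ext fun v => Completion.induction_on v
    (isClosed_eq (ContinuousLinearMap.continuous _) (ContinuousLinearMap.continuous _)) fun v => by
      rw [add_apply, ContinuousLinearMap.completion_apply_coe,
        ContinuousLinearMap.completion_apply_coe, ContinuousLinearMap.completion_apply_coe]
      exact Completion.coe_add (f v) (g v)

variable {H K : Type*} [NormedAddCommGroup H] [InnerProductSpace ℂ H]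
  [NormedAddCommGroup K] [InnerProductSpace ℂ K] [CompleteSpace K]

theorem tensorOperator_coe (x : H →L[ℂ] H) (y : K →L[ℂ] K) (v : H ⊗[ℂ] StrongDual ℂ K) :
    tensorOperator x y (v : HilbertTensor H (StrongDual ℂ K)) =
      ((TensorProduct.map x.toLinearMap (transpose y).toLinearMap v : H ⊗[ℂ] StrongDual ℂ K) :
        HilbertTensor H (StrongDual ℂ K)) := by
  rw [tensorOperator, ContinuousLinearMap.completion_apply_coe, TensorProduct.mapL_apply]

theorem hilbertTensor_ext {S T : HilbertTensor H (StrongDual ℂ K) →L[ℂ]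
      HilbertTensor H (StrongDual ℂ K)}
    (h : ∀ v : H ⊗[ℂ] StrongDual ℂ K, S v = T v) : S = T :=
  ContinuousLinearMap.ext fun v =>
    Completion.induction_on v (isClosed_eq S.continuous T.continuous) h

theorem tensorOperator_add_left (x x' : H →L[ℂ] H) (y : K →L[ℂ] K) :
    tensorOperator (x + x') y = tensorOperator x y + tensorOperator x' y := by
  unfold tensorOperator
  rw [TensorProduct.mapL_add_left]
  exact completion_add _ _

theorem tensorOperator_smul_left (a : ℂ) (x : H →L[ℂ] H) (y : K →L[ℂ] K) :
    tensorOperator (a • x) y = a • tensorOperator x y := by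
  unfold tensorOperator
  rw [TensorProduct.mapL_smul_left]
  exact completion_smul a _

theorem tensorOperator_add_right (x : H →L[ℂ] H) (y y' : K →L[ℂ] K) :
    tensorOperator x (y + y') = tensorOperator x y + tensorOperator x y' := by
  have h : transpose (y + y') = transpose y + transpose y' := by
    ext f w
    exact map_add f _ _
  unfold tensorOperator
  rw [h, TensorProduct.mapL_add_right]
  exact completion_add _ _

theorem tensorOperator_smul_right (a : ℂ) (x : H →L[ℂ] H) (y : K →L[ℂ] K) :
    tensorOperator x (a • y) = a • tensorOperator x y := by
  have h : transpose (a • y) = a • transpose y := by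
    ext f w
    exact map_smul f _ _
  unfold tensorOperator
  rw [h, TensorProduct.mapL_smul_right]
  exact completion_smul a _

variable [CompleteSpace H] {N₁ : VonNeumannAlgebra H} {N₂ : VonNeumannAlgebra K}

theorem tmul_mul_tmul (x x' : Elt N₁) (y y' : Elt N₂) :
    tmul x y * tmul x' y' = tmul (x * x') (y' * y) := by
  refine Subtype.ext (hilbertTensor_ext fun v => ?_)
  change tensorOperator x.1 y.1 (tensorOperator x'.1 y'.1 v) =
    tensorOperator (x.1 * x'.1) (y'.1 * y.1) v
  rw [tensorOperator_coe, tensorOperator_coe, tensorOperator_coe, ← LinearMap.comp_apply,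
    ← TensorProduct.map_comp]
  rfl

/-- `x ⊗ yᵒᵖᵖ` as a bilinear map of `x` and `y`. -/
noncomputable def tmulBilinear (N₁ : VonNeumannAlgebra H) (N₂ : VonNeumannAlgebra K) :
    Elt N₁ →ₗ[ℂ] Elt N₂ →ₗ[ℂ] Elt (tensorOpp N₁ N₂) :=
  LinearMap.mk₂ ℂ tmul
    (fun x x' y => Subtype.ext (tensorOperator_add_left x.1 x'.1 y.1))
    (fun a x y => Subtype.ext (tensorOperator_smul_left a x.1 y.1))
    (fun x y y' => Subtype.ext (tensorOperator_add_right x.1 y.1 y'.1))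
    (fun a x y => Subtype.ext (tensorOperator_smul_right a x.1 y.1))

theorem tmulBilinear_apply (x : Elt N₁) (y : Elt N₂) : tmulBilinear N₁ N₂ x y = tmul x y := rfl

end Tensor

/-! ### Orthonormal systems of isometries -/

section Isometries

variable {A : Type*} [Ring A] [StarRing A]

/-- An operator `∑ j, C_{σ j} τ_j C_j*` fixes `∑ j, C_j Y_j` if `τ_j Y_j = Y_{σ j}`. -/
theorem sum_permuted_mul_sum {J : Type*} [Fintype J] (C τ Y : J → A)
    (hC : ∀ j, star (C j) * C j = 1) (hC' : ∀ i j, i ≠ j → star (C i) * C j = 0) (σ : J ≃ J)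
    (h : ∀ j, τ j * Y j = Y (σ j)) :
    (∑ j, C (σ j) * τ j * star (C j)) * ∑ j, C j * Y j = ∑ j, C j * Y j := by
  rw [Finset.sum_mul]
  refine Eq.trans ?_ (Equiv.sum_comp σ fun j => C j * Y j)
  refine Finset.sum_congr rfl fun i _ => ?_
  rw [Finset.mul_sum, Finset.sum_eq_single i]
  · calc C (σ i) * τ i * star (C i) * (C i * Y i)
        = C (σ i) * τ i * ((star (C i) * C i) * Y i) := by simp only [mul_assoc]
      _ = C (σ i) * Y (σ i) := by rw [hC, one_mul, mul_assoc, h]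
  · intro j _ hj
    calc C (σ i) * τ i * star (C i) * (C j * Y j)
        = C (σ i) * τ i * ((star (C i) * C j) * Y j) := by simp only [mul_assoc]
      _ = 0 := by rw [hC' i j hj.symm, zero_mul, mul_zero]
  · simp

variable [Algebra ℂ A] {I : Type*} [Fintype I] (W : IsometrySystem I A) (Λ : I → (A →⋆ₐ[ℂ] A))

theorem IsometrySystem.star_cross_mul_cross (l m l' m' : I) :
    star (cross (Λ l) (W.W l) (W.W m)) * cross (Λ l') (W.W l') (W.W m') =
      star (Λ l (W.W m)) * (star (W.W l) * W.W l') * Λ l' (W.W m') := by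
  simp only [cross, star_mul, mul_assoc]

/-- The products `W_l × W_m` are isometries, for whatever *-homomorphisms `Λ_l`. -/
theorem IsometrySystem.cross_isometry (j : I × I) :
    star (cross (Λ j.1) (W.W j.1) (W.W j.2)) * cross (Λ j.1) (W.W j.1) (W.W j.2) = 1 := by
  rw [W.star_cross_mul_cross, W.isometry, mul_one, ← map_star, ← map_mul, W.isometry, map_one]

theorem IsometrySystem.cross_orthogonal (i j : I × I) (h : i ≠ j) :
    star (cross (Λ i.1) (W.W i.1) (W.W i.2)) * cross (Λ j.1) (W.W j.1) (W.W j.2) = 0 := by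
  rw [W.star_cross_mul_cross]
  by_cases hl : i.1 = j.1
  · have hm : i.2 ≠ j.2 := fun hm => h (Prod.ext hl hm)
    rw [← hl, W.isometry, mul_one, ← map_star, ← map_mul, W.orthogonal _ _ hm, map_zero]
  · rw [W.orthogonal _ _ hl, mul_zero, zero_mul]

end Isometries

/-! ### The matrices of the braidings -/

section Matrices

variable {P : Type*} [Ring P] [StarRing P] [Algebra ℂ P]

theorem FusionBases.mem_Hom {Δ : Set (P →⋆ₐ[ℂ] P)} (T : FusionBases Δ) (τ ρ σ : Δ) (e) :
    T.T τ ρ σ e ∈ Hom (τ : P →⋆ₐ[ℂ] P) (ρ * σ) := by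
  rw [← T.span]
  exact Submodule.subset_span ⟨e, rfl⟩

/-- The matrix of `ε(ρ, σ) : Hom(τ, ρσ) → Hom(τ, σρ)` in the chosen bases, and of its inverse. -/
theorem UnitaryBraiding.exists_coefficients [StarModule ℂ P] [Nontrivial P]
    {Δ : Set (P →⋆ₐ[ℂ] P)} (ε : UnitaryBraiding Δ) (T : FusionBases Δ) (τ ρ σ : Δ) :
    ∃ a : Fin (Module.finrank ℂ (Hom (τ : P →⋆ₐ[ℂ] P) (σ * ρ))) →
        Fin (Module.finrank ℂ (Hom (τ : P →⋆ₐ[ℂ] P) (ρ * σ))) → ℂ,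
      (∀ e, ε.op ρ σ * T.T τ ρ σ e = ∑ f, a f e • T.T τ σ ρ f) ∧
      ∀ f, star (ε.op ρ σ) * T.T τ σ ρ f = ∑ e, star (a f e) • T.T τ ρ σ e := by
  have hε : ε.op ρ σ ∈ Hom ((ρ : P →⋆ₐ[ℂ] P) * (σ : P →⋆ₐ[ℂ] P)) ((σ : P →⋆ₐ[ℂ] P) * ρ) :=
    ε.mem_hom _ _
  apply exists_unitary_coefficients (T.isometry τ ρ σ) (T.orthogonal τ ρ σ) (T.isometry τ σ ρ)
    (T.orthogonal τ σ ρ)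
  · intro e
    rw [T.span]
    exact mul_mem_Hom hε (T.mem_Hom τ ρ σ e)
  · intro f
    rw [T.span]
    exact mul_mem_Hom (star_mem_Hom hε) (T.mem_Hom τ σ ρ f)

variable {P' Q : Type*} [Ring P'] [StarRing P'] [Algebra ℂ P'] 
  [Ring Q] [StarRing Q] [Algebra ℂ Q] {κ κ' μ μ' : Type*}
  [Fintype κ] [Fintype κ'] [Fintype μ] [Fintype μ']

/-- A change of basis by `u` and `v` in the outer arguments of `Φ_ρ` can be absorbed into the middle
argument `x`. -/
theorem scalarValue_leftInverse_change_basis [StarModule ℂ P] [PartialOrder P] [Nontrivial Q]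
    {Δ : Set (P →⋆ₐ[ℂ] P)} (c : ConjugateChoice Δ) (ι : P →⋆ₐ[ℂ] Q) (ι' : P' →⋆ₐ[ℂ] Q)
    (α : Δ → (Q →⋆ₐ[ℂ] Q)) (ρ : Δ) {T : κ → P} {T' : κ' → P'} {S u : P} {S' v : P'}
    {a : κ → ℂ} {a' : κ' → ℂ} {x y z : Q}
    (ha : star u * S = ∑ e, star (a e) • T e) (ha' : star v * S' = ∑ e, star (a' e) • T' e)
    (hx : ι u * x * star (ι' v) = y)
    (h : ∀ e e', ∃ b : ℂ, c.leftInverse ι α ρ (ι (star (T e)) * x * ι' (T' e') * z) = b • (1 : Q)) :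
    scalarValue (c.leftInverse ι α ρ (ι (star S) * y * ι' S' * z)) =
      ∑ e : κ × κ', (a e.1 * star (a' e.2)) *
        scalarValue (c.leftInverse ι α ρ (ι (star (T e.1)) * x * ι' (T' e.2) * z)) := by
  have s := congrArg (fun x => ι (star x)) ha
  have s' := congrArg ι' ha'
  simp only [star_mul, star_star, star_sum, star_smul, map_mul, map_sum, map_smul] at s s'
  have key : ι (star S) * y * ι' S' * z =
      ∑ e : κ × κ', (a e.1 * star (a' e.2)) • (ι (star (T e.1)) * x * ι' (T' e.2) * z) := by
    calc _ = (ι (star S) * ι u) * x * (ι' (star v) * ι' S') * z := by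
          simp only [← hx, map_star, mul_assoc]
      _ = _ := by
          rw [s, s', Fintype.sum_prod_type, Finset.sum_mul, Finset.sum_mul_sum, Finset.sum_mul]
          refine Finset.sum_congr rfl fun e _ => ?_
          rw [Finset.sum_mul]
          refine Finset.sum_congr rfl fun e' _ => ?_
          simp only [smul_mul_assoc, mul_smul_comm, smul_smul]
          rw [mul_comm]
  rw [key, leftInverse_sum,
    scalarValue_sum (fun e : κ × κ' => a e.1 * star (a' e.2)) fun e => h e.1 e.2]

/-- A change of basis in both arguments of a bilinear map acts on the coefficients by the matrices
`a` and `ā'`; the second matrix is conjugated because the bilinear map is evaluated at adjoints. -/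
theorem mul_sum_bilinear_change_basis {P : Type*} [Ring P] [Algebra ℂ P] [StarModule ℂ P']
    {A : Type*} [Ring A] [Algebra ℂ A] (B : P →ₗ[ℂ] P' →ₗ[ℂ] A) {T : κ → P} {T' : κ' → P'}
    {S : μ → P} {S' : μ' → P'} {u : P} {v : P'} {a : μ → κ → ℂ} {a' : μ' → κ' → ℂ} {C : A}
    {ζ : κ → κ' → ℂ} {ζ' : μ → μ' → ℂ}
    (ha : ∀ e, u * T e = ∑ f, a f e • S f) (ha' : ∀ e, v * T' e = ∑ f, a' f e • S' f)
    (hC : ∀ e e', C * B (T e) (star (T' e')) = B (u * T e) (star (v * T' e')))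
    (hζ : ∀ f f', ζ' f f' = ∑ e : κ × κ', (a f e.1 * star (a' f' e.2)) * ζ e.1 e.2) :
    C * (∑ e, ∑ e', ζ e e' • B (T e) (star (T' e'))) =
      ∑ f, ∑ f', ζ' f f' • B (S f) (star (S' f')) := by
  have hT : ∀ e e', C * B (T e) (star (T' e')) =
      ∑ f : μ × μ', (a f.1 e * star (a' f.2 e')) • B (S f.1) (star (S' f.2)) := by
    intro e e'
    rw [hC, ha, map_sum, LinearMap.sum_apply, Fintype.sum_prod_type, ha', star_sum]
    refine Finset.sum_congr rfl fun f _ => ?_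
    rw [map_sum]
    refine Finset.sum_congr rfl fun f' _ => ?_
    rw [star_smul, map_smul, map_smul, LinearMap.smul_apply, smul_smul, mul_comm]
  rw [← Fintype.sum_prod_type', ← Fintype.sum_prod_type', Finset.mul_sum]
  simp only [mul_smul_comm, hT, Finset.smul_sum]
  rw [Finset.sum_comm]
  refine Finset.sum_congr rfl fun f _ => ?_
  rw [hζ, Finset.sum_smul]
  refine Finset.sum_congr rfl fun e _ => ?_
  rw [smul_smul, mul_comm]

end Matrices

/-! ### Braiding symmetry of the canonical isometry -/

section Construction

variable {H : Type*} [NormedAddCommGroup H] [InnerProductSpace ℂ H] [CompleteSpace H]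
  {N₁ N₂ M : VonNeumannAlgebra H} {h₁ : N₁ ≤ M} {h₂ : N₂ ≤ M}
  {Δ₁ : Set (Elt N₁ →⋆ₐ[ℂ] Elt N₁)} {Δ₂ : Set (Elt N₂ →⋆ₐ[ℂ] Elt N₂)}
  {α₁ : Δ₁ → (Elt M →⋆ₐ[ℂ] Elt M)} {α₂ : Δ₂ → (Elt M →⋆ₐ[ℂ] Elt M)}

theorem TransitionBases.mem_Hom {ι₁ : Elt N₁ →⋆ₐ[ℂ] Elt M} {c : ConjugateChoice Δ₁}
    (φ : TransitionBases ι₁ c α₁ α₂) (l : MultiIndex α₁ α₂) :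
    φ.φ l ∈ Hom (α₁ l.1.1) (α₂ l.1.2) := by
  obtain ⟨p, k⟩ := l
  rw [← φ.span p]
  exact Submodule.subset_span ⟨k, rfl⟩

variable [Fintype Δ₁] [Fintype Δ₂]

set_option maxHeartbeats 1000000 in
/-- Exchanging `l` and `m` transforms the coefficients `ζ` by the matrices of the braidings. -/
theorem zeta_swap (hM : IsTypeIIIFactor M) (hΔ₁ : IsClosedSystem Δ₁)
    (hα₁ : IsExtension (inclusionHom h₁) Δ₁ α₁) (hα₂ : IsExtension (inclusionHom h₂) Δ₂ α₂)
    (ε₁ : UnitaryBraiding Δ₁) (ε₂ : UnitaryBraiding Δ₂)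
    (hE3 : ∀ (l₁ m₁ : Δ₁) (l₂ m₂ : Δ₂), ∀ φ ∈ Hom (α₁ l₁) (α₂ l₂), ∀ ψ ∈ Hom (α₁ m₁) (α₂ m₂),
      cross (α₁ m₁) ψ φ * inclusionHom h₁ (ε₁.op l₁ m₁) =
        inclusionHom h₂ (ε₂.op l₂ m₂) * cross (α₁ l₁) φ ψ)
    (c : ConjugateChoice Δ₁) (T₁ : FusionBases Δ₁) (T₂ : FusionBases Δ₂)
    (φ : TransitionBases (inclusionHom h₁) c α₁ α₂)
    (W : IsometrySystem (MultiIndex α₁ α₂) (Elt (tensorOpp N₁ N₂)))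
    (l m n : MultiIndex α₁ α₂) (f₁) (f₂)
    (a₁ : Fin (Module.finrank ℂ (Hom (n.1.1 : Elt N₁ →⋆ₐ[ℂ] Elt N₁) (l.1.1 * m.1.1))) → ℂ)
    (a₂ : Fin (Module.finrank ℂ (Hom (n.1.2 : Elt N₂ →⋆ₐ[ℂ] Elt N₂) (l.1.2 * m.1.2))) → ℂ)
    (ha₁ : star (ε₁.op l.1.1 m.1.1) * T₁.T n.1.1 m.1.1 l.1.1 f₁ =
      ∑ e, star (a₁ e) • T₁.T n.1.1 l.1.1 m.1.1 e)
    (ha₂ : star (ε₂.op l.1.2 m.1.2) * T₂.T n.1.2 m.1.2 l.1.2 f₂ =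
      ∑ e, star (a₂ e) • T₂.T n.1.2 l.1.2 m.1.2 e) :
    zeta (inclusionHom h₁) (inclusionHom h₂) c T₁ T₂ φ W m l n f₁ f₂ =
      ∑ e : Fin _ × Fin _, (a₁ e.1 * star (a₂ e.2)) *
        zeta (inclusionHom h₁) (inclusionHom h₂) c T₁ T₂ φ W l m n e.1 e.2 := by
  have := hM.nontrivial
  have hX : cross (α₂ l.1.2) (star (φ.φ l)) (star (φ.φ m)) ∈
      Hom (α₂ l.1.2 * α₂ m.1.2) (α₁ l.1.1 * α₁ m.1.1) :=
    cross_mem_Hom (star_mem_Hom (φ.mem_Hom l)) (star_mem_Hom (φ.mem_Hom m))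
  have hu : inclusionHom h₁ (ε₁.op l.1.1 m.1.1) *
      star (inclusionHom h₁ (ε₁.op l.1.1 m.1.1)) = 1 := by
    rw [← map_star, ← map_mul, UnitaryBraiding.op, ε₁.mul_star_self, map_one]
  have hX' := braiding_conj_star_cross (φ.mem_Hom l) (φ.mem_Hom m) hu
    (hE3 _ _ _ _ _ (φ.mem_Hom l) _ (φ.mem_Hom m))
  rw [zeta, scalarValue_leftInverse_change_basis c _ _ α₁ n.1.1 ha₁ ha₂ hX', Finset.mul_sum]
  · refine Finset.sum_congr rfl fun e _ => ?_
    rw [zeta, mul_comm (dim (m.1.2 : Elt N₂ →⋆ₐ[ℂ] Elt N₂))]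
    exact mul_left_comm (_ : ℂ) _ _
  · intro e₁ e₂
    -- By (E2) the argument of `Φ¹_ν` lies in `Hom(α¹_ν, α¹_ν)`.
    apply leftInverse_scalar hα₁ hΔ₁.id_mem hM.center
    have t₁ := star_mem_Hom (hα₁.map_hom _ _ _ _ (T₁.mem_Hom n.1.1 l.1.1 m.1.1 e₁))
    have t₂ := hα₂.map_hom _ _ _ _ (T₂.mem_Hom n.1.2 l.1.2 m.1.2 e₂)
    rw [← map_star] at t₁
    exact mul_mem_Hom (mul_mem_Hom (mul_mem_Hom t₁ hX) t₂) (φ.mem_Hom n)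

set_option maxHeartbeats 1000000 in
/-- The braiding operator of `λ₁ ⊗ λ₂ᵒᵖᵖ` and `μ₁ ⊗ μ₂ᵒᵖᵖ` maps the intertwiner with coefficients
`ζ_{lm}` to the one with coefficients `ζ_{ml}`. -/
theorem braiding_mul_coefficients (hM : IsTypeIIIFactor M) (hN₁ : IsTypeIIIFactor N₁)
    (hN₂ : IsTypeIIIFactor N₂) (hΔ₁ : IsClosedSystem Δ₁)
    (hα₁ : IsExtension (inclusionHom h₁) Δ₁ α₁) (hα₂ : IsExtension (inclusionHom h₂) Δ₂ α₂)
    (ε₁ : UnitaryBraiding Δ₁) (ε₂ : UnitaryBraiding Δ₂)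
    (hE3 : ∀ (l₁ m₁ : Δ₁) (l₂ m₂ : Δ₂), ∀ φ ∈ Hom (α₁ l₁) (α₂ l₂), ∀ ψ ∈ Hom (α₁ m₁) (α₂ m₂),
      cross (α₁ m₁) ψ φ * inclusionHom h₁ (ε₁.op l₁ m₁) =
        inclusionHom h₂ (ε₂.op l₂ m₂) * cross (α₁ l₁) φ ψ)
    (c : ConjugateChoice Δ₁) (T₁ : FusionBases Δ₁) (T₂ : FusionBases Δ₂)
    (φ : TransitionBases (inclusionHom h₁) c α₁ α₂)
    (W : IsometrySystem (MultiIndex α₁ α₂) (Elt (tensorOpp N₁ N₂)))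
    (l m n : MultiIndex α₁ α₂) :
    tmul (ε₁.op l.1.1 m.1.1) (star (ε₂.op l.1.2 m.1.2)) *
        (∑ e₁, ∑ e₂, zeta (inclusionHom h₁) (inclusionHom h₂) c T₁ T₂ φ W l m n e₁ e₂ •
          tmul (T₁.T n.1.1 l.1.1 m.1.1 e₁) (star (T₂.T n.1.2 l.1.2 m.1.2 e₂))) =
      ∑ f₁, ∑ f₂, zeta (inclusionHom h₁) (inclusionHom h₂) c T₁ T₂ φ W m l n f₁ f₂ •
        tmul (T₁.T n.1.1 m.1.1 l.1.1 f₁) (star (T₂.T n.1.2 m.1.2 l.1.2 f₂)) := by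
  have := hN₁.nontrivial
  have := hN₂.nontrivial
  obtain ⟨a₁, ha₁, hb₁⟩ := ε₁.exists_coefficients T₁ n.1.1 l.1.1 m.1.1
  obtain ⟨a₂, ha₂, hb₂⟩ := ε₂.exists_coefficients T₂ n.1.2 l.1.2 m.1.2
  refine mul_sum_bilinear_change_basis (tmulBilinear N₁ N₂) ha₁ ha₂ (fun e₁ e₂ => ?_)
    fun f₁ f₂ => zeta_swap hM hΔ₁ hα₁ hα₂ ε₁ ε₂ hE3 c T₁ T₂ φ W l m n f₁ f₂ (a₁ f₁) (a₂ f₂)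
      (hb₁ f₁) (hb₂ f₂)
  rw [tmulBilinear_apply, tmulBilinear_apply, tmul_mul_tmul, ← star_mul]

end Construction

end SectorSystems

set_option maxHeartbeats 1000000 in
open SectorSystems in
theorem proposition1 {H : Type*} [NormedAddCommGroup H] [InnerProductSpace ℂ H] [CompleteSpace H]
    (M N₁ N₂ : VonNeumannAlgebra H)
    (hM : IsTypeIIIFactor M) (hN₁ : IsTypeIIIFactor N₁) (hN₂ : IsTypeIIIFactor N₂)
    (h₁ : N₁ ≤ M) (h₂ : N₂ ≤ M)
    (Δ₁ : Set (Elt N₁ →⋆ₐ[ℂ] Elt N₁)) (Δ₂ : Set (Elt N₂ →⋆ₐ[ℂ] Elt N₂))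
    [Fintype Δ₁] [Fintype Δ₂]
    (hΔ₁ : IsClosedSystem Δ₁) (hΔ₂ : IsClosedSystem Δ₂)
    (α₁ : Δ₁ → (Elt M →⋆ₐ[ℂ] Elt M)) (α₂ : Δ₂ → (Elt M →⋆ₐ[ℂ] Elt M))
    (hα₁ : IsExtension (inclusionHom h₁) Δ₁ α₁) (hα₂ : IsExtension (inclusionHom h₂) Δ₂ α₂)
    (ε₁ : UnitaryBraiding Δ₁) (ε₂ : UnitaryBraiding Δ₂)
    (hE3 : ∀ (l₁ m₁ : Δ₁) (l₂ m₂ : Δ₂), ∀ φ ∈ Hom (α₁ l₁) (α₂ l₂), ∀ ψ ∈ Hom (α₁ m₁) (α₂ m₂),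
      cross (α₁ m₁) ψ φ * inclusionHom h₁ (ε₁.op l₁ m₁) =
        inclusionHom h₂ (ε₂.op l₂ m₂) * cross (α₁ l₁) φ ψ)
    (c : ConjugateChoice Δ₁) (T₁ : FusionBases Δ₁) (T₂ : FusionBases Δ₂)
    (φ : TransitionBases (inclusionHom h₁) c α₁ α₂)
    (W : IsometrySystem (MultiIndex α₁ α₂) (Elt (tensorOpp N₁ N₂))) :
    inducedBraiding ε₁ ε₂ W * w₁ (inclusionHom h₁) (inclusionHom h₂) c T₁ T₂ φ W =
      w₁ (inclusionHom h₁) (inclusionHom h₂) c T₁ T₂ φ W := by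
  -- The part of `w₁` that belongs to the pair `j = (l, m)`, without the factor `W_l × W_m`.
  let Y : MultiIndex α₁ α₂ × MultiIndex α₁ α₂ → Elt (tensorOpp N₁ N₂) := fun j =>
    ∑ n, (∑ e₁, ∑ e₂, zeta (inclusionHom h₁) (inclusionHom h₂) c T₁ T₂ φ W j.1 j.2 n e₁ e₂ •
      tmul (T₁.T n.1.1 j.1.1.1 j.2.1.1 e₁) (star (T₂.T n.1.2 j.1.1.2 j.2.1.2 e₂))) * star (W.W n)
  let C : MultiIndex α₁ α₂ × MultiIndex α₁ α₂ → Elt (tensorOpp N₁ N₂) := fun j => crossW W j.1 j.2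
  let τ : MultiIndex α₁ α₂ × MultiIndex α₁ α₂ → Elt (tensorOpp N₁ N₂) := fun j =>
    tmul (ε₁.op j.1.1.1 j.2.1.1) (star (ε₂.op j.1.1.2 j.2.1.2))
  let σ : MultiIndex α₁ α₂ × MultiIndex α₁ α₂ ≃ MultiIndex α₁ α₂ × MultiIndex α₁ α₂ :=
    Equiv.prodComm _ _
  have hw : w₁ (inclusionHom h₁) (inclusionHom h₂) c T₁ T₂ φ W = ∑ j, C j * Y j := by
    rw [w₁, Fintype.sum_prod_type]
    refine Finset.sum_congr rfl fun l _ => Finset.sum_congr rfl fun m _ => ?_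
    change _ = _ * ∑ n, _
    rw [Finset.mul_sum]
    exact Finset.sum_congr rfl fun n _ => mul_assoc _ _ _
  have hε : inducedBraiding ε₁ ε₂ W = ∑ j, C (σ j) * τ j * star (C j) := by
    rw [inducedBraiding, Fintype.sum_prod_type]
    rfl
  have hC : ∀ j, star (C j) * C j = 1 := W.cross_isometry component
  have hC' : ∀ i j, i ≠ j → star (C i) * C j = 0 := W.cross_orthogonal component
  have hY : ∀ j, τ j * Y j = Y (σ j) := fun j => by
    change _ * (∑ n, _) = ∑ n, _
    rw [Finset.mul_sum]
    refine Finset.sum_congr rfl fun n _ => ?_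
    rw [← mul_assoc]
    exact congrArg (· * star (W.W n))
      (braiding_mul_coefficients hM hN₁ hN₂ hΔ₁ hα₁ hα₂ ε₁ ε₂ hE3 c T₁ T₂ φ W j.1 j.2 n)
  rw [hw, hε]
  exact sum_permuted_mul_sum C τ Y hC hC' σ hY
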